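/- Let $k\ge 1$ be an integer. All graphs are finite, may have parallel edges and loops, and have no isolated vertices. For a graph $G$ and $C\subseteq E(G)$ let $G\langle C\rangle$ be the subgraph formed by the edges of $C$ and their end vertices. Let $M_k(G)$ be the matroid on $E(G)$ whose circuits are the sets $C\subseteq E(G)$ such that $|C|-|V(G\langle C\rangle)|=k$ and $G\langle C\rangle$ has no isolated vertices, no leaves (vertices of degree one) and no component that is a cycle (a loop, or a pair of parallel edges, also counts as a cycle). A matroid is called connected if it has no loops, no coloops, and every two elements belong to a common circuit. A non-separating cocircuit of a connected matroid $M$ is a cocircuit $K$ such that $M\setminus K$ is connected. For a vertex $v$ of $G$ let $S(v,G)$ be its star, i.e. the set of edges of $G$ incident to $v$, and let $\mathcal S(G)=\{S(v,G):v\in V(G)\}$. Graphs $G$ and $G'$ with $E(G)=E(G')$ are strongly isomorphic if there is a bijection $\nu:V(G)\to V(G')$ such that, for every edge $e$ and all vertices $x,y$ of $G$, $e$ has ends $x,y$ in $G$ if and only if $e$ has ends $\nu(x),\nu(y)$ in $G'$. **Theorem.** Let $G$ and $G'$ be graphs and $k\ge 1$. Suppose that - $G$ and $G'$ have no loops, -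 $M_k(G)$ is a connected matroid, - $G$ has exactly one vertex $v$ such that $S(v,G)$ is not a non-separating cocircuit of $M_k(G)$, and - $M_k(G')=M_k(G)$. Then $\mathcal S(G)=\mathcal S(G')$; that is, $G$ and $G'$ are strongly isomorphic. -/

import Mathlib

open Graph

namespace KCircular

/-- The degree of a vertex; a loop contributes `2`. -/
noncomputable def degree {α β : Type*} (G : Graph α β) (x : α) : ℕ :=
  {e | G.IsNonloopAt e x}.ncard + 2 * {e | G.IsLoopAt e x}.ncard

/-- The subgraph `G⟨X⟩` induced by a set `X` of edges: its edges are the edges of `G` in `X`, its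
vertices are the ends of these edges. -/
def edgeInduced {α β : Type*} (G : Graph α β) (X : Set β) : Graph α β where
  vertexSet := {x | ∃ e ∈ X, G.Inc e x}
  IsLink e x y := e ∈ X ∧ G.IsLink e x y
  edgeSet := {e | e ∈ X ∧ e ∈ E(G)}
  isLink_symm _ _ := ⟨fun _ _ h => ⟨h.1, h.2.symm⟩⟩
  eq_or_eq_of_isLink_of_isLink _ _ _ _ _ h h' := h.2.left_eq_or_eq h'.2
  edge_mem_iff_exists_isLink e := by
    constructor
    · rintro ⟨h, he⟩
      obtain ⟨x, y, hxy⟩ := exists_isLink_of_mem_edgeSet he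
      exact ⟨x, y, h, hxy⟩
    · rintro ⟨x, y, h, hxy⟩
      exact ⟨h, hxy.edge_mem⟩
  left_mem_of_isLink e x y h := ⟨e, h.1, y, h.2⟩

/-- `Δ H = |E(H)| - |V(H)|` for a finite graph `H`. -/
noncomputable def delta {α β : Type*} (H : Graph α β) : ℤ := (E(H).ncard : ℤ) - V(H).ncard

/-- The vertex set of the connected component of `H` containing `x`. -/
def componentVerts {α β : Type*} (H : Graph α β) (x : α) : Set α :=
  {y | Relation.ReflTransGen H.Adj x y}

/-- The connected component of `H` containing the vertex `x` is a cycle (a loop and a pair of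
parallel edges count as cycles of length `1` and `2`), i.e. that component is `2`-regular. -/
def IsCycleComponentAt {α β : Type*} (H : Graph α β) (x : α) : Prop :=
  ∀ y ∈ componentVerts H x, degree H y = 2

/-- A cacti-graph: no isolated vertices, no leaves and no cycle components. -/
structure IsCactiGraph {α β : Type*} (H : Graph α β) : Prop where
  no_isolated : ∀ x ∈ V(H), (H.incidenceSet x).Nonempty
  no_leaf : ∀ x ∈ V(H), degree H x ≠ 1
  no_cycle_component : ∀ x ∈ V(H), ¬ IsCycleComponentAt H x

/-- The family `𝒞ₖ(G)` of `k`-circuits of `G`. -/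
def kCircuits {α β : Type*} (G : Graph α β) (k : ℕ) : Set (Set β) :=
  {C | C ⊆ E(G) ∧ delta (edgeInduced G C) = k ∧ IsCactiGraph (edgeInduced G C)}

/-- A set of edges containing no `k`-circuit. -/
def KIndep {α β : Type*} (G : Graph α β) (k : ℕ) (X : Set β) : Prop :=
  X ⊆ E(G) ∧ ∀ C ∈ kCircuits G k, ¬ C ⊆ X

section aux

variable {α β : Type*} {G : Graph α β} {k : ℕ} {X Y C : Set β}

lemma finite_ends (hX : X.Finite) : {x | ∃ e ∈ X, G.Inc e x}.Finite := by
  have : {x | ∃ e ∈ X, G.Inc e x} = ⋃ e ∈ X, {x | G.Inc e x} := by ext; simp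
  rw [this]
  refine hX.biUnion fun e _ => ?_
  by_cases he : e ∈ E(G)
  · obtain ⟨a, b, hab⟩ := exists_isLink_of_mem_edgeSet he
    exact (Set.toFinite {a, b}).subset fun x hx => hx.eq_or_eq_of_isLink hab
  · convert Set.finite_empty
    ext x
    simp [G.not_inc_of_notMem_edgeSet he]

lemma edgeSet_edgeInduced (hX : X ⊆ E(G)) : E(edgeInduced G X) = X :=
  Set.ext fun _ => ⟨fun h => h.1, fun h => ⟨h, hX h⟩⟩

lemma delta_eq_iff (hC : C ⊆ E(G)) : delta (edgeInduced G C) = k ↔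
    C.ncard = V(edgeInduced G C).ncard + k := by
  rw [delta, edgeSet_edgeInduced hC]
  omega

open Classical in
lemma mult_eq {H : Graph α β} {e : β} {a b x : α} (h : H.IsLink e a b) :
    (if H.IsNonloopAt e x then 1 else 0) + 2 * (if H.IsLoopAt e x then 1 else 0) =
      (if a = x then 1 else 0) + (if b = x then 1 else 0) := by
  have h1 : H.IsLoopAt e x ↔ a = x ∧ b = x := by
    rw [IsLoopAt, h.isLink_iff]
    tauto
  have h2 : H.IsNonloopAt e x ↔ (a = x ∧ b ≠ x) ∨ (b = x ∧ a ≠ x) := by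
    constructor
    · rintro ⟨y, hy, hl⟩
      rw [h.isLink_iff] at hl
      rcases hl with ⟨rfl, rfl⟩ | ⟨rfl, rfl⟩
      · exact Or.inl ⟨rfl, hy⟩
      · exact Or.inr ⟨rfl, hy⟩
    · rintro (⟨rfl, hb⟩ | ⟨rfl, ha⟩)
      · exact ⟨b, hb, h⟩
      · exact ⟨a, ha, h.symm⟩
  by_cases ha : a = x <;> by_cases hb : b = x <;> simp [h1, h2, ha, hb]

open Classical in
lemma degree_eq_sum {H : Graph α β} (F : Finset β) (x : α) (hF : ∀ e, H.Inc e x → e ∈ F) :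
    degree H x = ∑ e ∈ F, ((if H.IsNonloopAt e x then 1 else 0) +
      2 * (if H.IsLoopAt e x then 1 else 0)) := by
  have h1 : {e | H.IsNonloopAt e x} = ↑(F.filter fun e => H.IsNonloopAt e x) := by
    ext e
    simpa using fun h => hF e h.inc
  have h2 : {e | H.IsLoopAt e x} = ↑(F.filter fun e => H.IsLoopAt e x) := by
    ext e
    simpa using fun h => hF e h.inc
  rw [degree, h1, h2, Set.ncard_coe_finset, Set.ncard_coe_finset, Finset.sum_add_distrib,
    ← Finset.mul_sum, Finset.card_filter, Finset.card_filter]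

open Classical in
lemma sum_degree_eq {H : Graph α β} (F : Finset β) (W : Finset α)
    (hF : ∀ x ∈ W, ∀ e, H.Inc e x → e ∈ F) :
    ∑ x ∈ W, degree H x = ∑ e ∈ F, ∑ x ∈ W, ((if H.IsNonloopAt e x then 1 else 0) +
      2 * (if H.IsLoopAt e x then 1 else 0)) := by
  rw [Finset.sum_comm]
  exact Finset.sum_congr rfl fun x hx => degree_eq_sum F x (hF x hx)

open Classical in
lemma sum_mult_eq {H : Graph α β} {e : β} {a b : α} (W : Finset α) (h : H.IsLink e a b) :
    ∑ x ∈ W, ((if H.IsNonloopAt e x then 1 else 0) + 2 * (if H.IsLoopAt e x then 1 else 0)) =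
      (if a ∈ W then 1 else 0) + (if b ∈ W then 1 else 0) := by
  rw [Finset.sum_congr rfl fun x _ => mult_eq h, Finset.sum_add_distrib, Finset.sum_ite_eq,
    Finset.sum_ite_eq]

/-- A nonempty-or-empty finite edge set `Y` with `Δ ≥ k` contains a `k`-circuit. -/
lemma exists_kCircuit (hk : 1 ≤ k) (hY : Y.Finite) (hYE : Y ⊆ E(G))
    (h : V(edgeInduced G Y).ncard + k ≤ Y.ncard) : ∃ C ∈ kCircuits G k, C ⊆ Y := by
  classical
  induction hn : Y.ncard using Nat.strong_induction_on generalizing Y with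
  | _ n ih =>
  subst hn
  -- a proper subset that still has `Δ ≥ k` finishes the proof
  have step : ∀ Z ⊂ Y, V(edgeInduced G Z).ncard + k ≤ Z.ncard → ∃ C ∈ kCircuits G k, C ⊆ Y := by
    intro Z hZ hZk
    obtain ⟨C, hC, hCZ⟩ := ih _ (Set.ncard_lt_ncard hZ hY) (hY.subset hZ.subset)
      (hZ.subset.trans hYE) hZk rfl
    exact ⟨C, hC, hCZ.trans hZ.subset⟩
  by_contra hcon
  have hmin : ∀ Z ⊂ Y, Z.ncard < V(edgeInduced G Z).ncard + k := fun Z hZ => by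
    by_contra hlt
    exact hcon (step Z hZ (not_lt.1 hlt))
  apply hcon
  have hVfin : V(edgeInduced G Y).Finite := finite_ends hY
  have hmono : ∀ Z ⊆ Y, V(edgeInduced G Z) ⊆ V(edgeInduced G Y) :=
    fun Z hZ x ⟨e, he, hx⟩ => ⟨e, hZ he, hx⟩
  refine ⟨Y, ⟨hYE, (delta_eq_iff hYE).2 ?_, ⟨?_, ?_, ?_⟩⟩, subset_rfl⟩
  · have hne : Y.Nonempty := by
      rw [Set.nonempty_iff_ne_empty]
      rintro rfl
      simp at h
      omega
    obtain ⟨e, he⟩ := hne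
    have h1 := hmin (Y \ {e}) (Set.sdiff_singleton_ssubset.2 he)
    have h2 := Set.ncard_sdiff_singleton_add_one he hY
    have h3 := Set.ncard_le_ncard (hmono (Y \ {e}) Set.sdiff_subset) hVfin
    omega
  · rintro x ⟨e, he, y, hy⟩
    exact ⟨e, y, he, hy⟩
  · rintro x ⟨e, he, y, hy⟩ hdeg
    have hsub : ∀ f, (edgeInduced G Y).Inc f x → f ∈ hY.toFinset := by
      rintro f ⟨z, hf, -⟩
      simpa using hf
    rw [degree_eq_sum _ x hsub] at hdeg
    have hpos : ∀ f, (edgeInduced G Y).Inc f x → 1 ≤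
        (if (edgeInduced G Y).IsNonloopAt f x then 1 else 0) +
          2 * (if (edgeInduced G Y).IsLoopAt f x then 1 else 0) := by
      rintro f ⟨z, hf⟩
      rw [mult_eq hf]
      simp
    have huniq : ∀ f, (edgeInduced G Y).Inc f x → f = e := by
      intro f hf
      by_contra hne
      have he' : (edgeInduced G Y).Inc e x := ⟨y, he, hy⟩
      have := Finset.sum_le_sum_of_subset (f := fun f =>
        (if (edgeInduced G Y).IsNonloopAt f x then 1 else 0) +
          2 * (if (edgeInduced G Y).IsLoopAt f x then 1 else 0))
        (show ({f, e} : Finset β) ⊆ hY.toFinset by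
          intro g hg
          simp only [Finset.mem_insert, Finset.mem_singleton] at hg
          rcases hg with rfl | rfl
          · exact hsub _ hf
          · exact hsub _ he')
      rw [Finset.sum_pair hne, hdeg] at this
      have := hpos f hf
      have := hpos e he'
      omega
    have h1 := hmin (Y \ {e}) (Set.sdiff_singleton_ssubset.2 he)
    have h2 := Set.ncard_sdiff_singleton_add_one he hY
    have hx : x ∈ V(edgeInduced G Y) := ⟨e, he, y, hy⟩
    have h3 : V(edgeInduced G (Y \ {e})) ⊆ V(edgeInduced G Y) \ {x} := by
      rintro w ⟨f, hf, hfw⟩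
      refine ⟨⟨f, hf.1, hfw⟩, ?_⟩
      rintro rfl
      obtain ⟨z, hz⟩ := hfw
      exact hf.2 (huniq f ⟨z, hf.1, hz⟩)
    have h4 := Set.ncard_le_ncard h3 hVfin.sdiff
    have h5 := Set.ncard_sdiff_singleton_add_one hx hVfin
    omega
  · intro x hx hcyc
    have hKsub : componentVerts (edgeInduced G Y) x ⊆ V(edgeInduced G Y) := by
      intro y hy
      rcases Relation.ReflTransGen.cases_tail hy with rfl | ⟨z, -, hz⟩
      · exact hx
      · exact hz.right_mem
    have hKfin := hVfin.subset hKsub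
    set K := componentVerts (edgeInduced G Y) x with hK
    have hclosed : ∀ e a b, (edgeInduced G Y).IsLink e a b → a ∈ K → b ∈ K :=
      fun e a b h ha => Relation.ReflTransGen.tail ha ⟨e, h⟩
    set F : Set β := {e | ∃ a ∈ K, (edgeInduced G Y).Inc e a} with hFdef
    have hFY : F ⊆ Y := by
      rintro e ⟨a, -, z, hz, -⟩
      exact hz
    have hFfin := hY.subset hFY
    have hcount := sum_degree_eq (H := edgeInduced G Y) hFfin.toFinset hKfin.toFinset (by
      intro a ha e he
      simp only [Set.Finite.mem_toFinset] at ha ⊢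
      exact ⟨a, ha, he⟩)
    rw [Finset.sum_congr rfl (g := fun _ => 2) (fun a ha => hcyc a (by simpa using ha)),
      Finset.sum_congr (s₁ := hFfin.toFinset) rfl (g := fun _ => 2) (by
        intro e he
        obtain ⟨a, ha, b, hab⟩ : e ∈ F := by simpa using he
        rw [sum_mult_eq _ hab]
        simp [ha, hclosed e a b hab ha])] at hcount
    simp only [Finset.sum_const, smul_eq_mul, ← Set.ncard_eq_toFinset_card] at hcount
    obtain ⟨e, he, hex⟩ := hx
    have heF : e ∈ F := by
      obtain ⟨z, hz⟩ := hex
      exact ⟨x, Relation.ReflTransGen.refl, z, he, hz⟩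
    have h1 := hmin (Y \ F) ⟨Set.sdiff_subset, fun hh => (hh he).2 heF⟩
    have h2 := Set.ncard_sdiff_add_ncard_of_subset hFY hY
    have h3 : V(edgeInduced G (Y \ F)) ⊆ V(edgeInduced G Y) \ K := by
      rintro w ⟨f, hf, hfw⟩
      refine ⟨⟨f, hf.1, hfw⟩, fun hw => hf.2 ?_⟩
      obtain ⟨z, hz⟩ := hfw
      exact ⟨w, hw, z, hf.1, hz⟩
    have h4 := Set.ncard_le_ncard h3 hVfin.sdiff
    have h5 := Set.ncard_sdiff_add_ncard_of_subset hKsub hVfin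
    omega

lemma kIndep_iff (hk : 1 ≤ k) (hG : E(G).Finite) : KIndep G k X ↔
    X ⊆ E(G) ∧ ∀ Y ⊆ X, Y.ncard < V(edgeInduced G Y).ncard + k := by
  refine and_congr_right fun hX => ⟨fun h Y hY => ?_, fun h C hC hCX => ?_⟩
  · by_contra hlt
    obtain ⟨C, hC, hCY⟩ := exists_kCircuit hk (hG.subset (hY.trans hX)) (hY.trans hX)
      (not_lt.1 hlt)
    exact h C hC (hCY.trans hY)
  · have h1 := h C hCX
    have h2 := (delta_eq_iff hC.1).1 hC.2.1
    omega

lemma kIndep_aug (hk : 1 ≤ k) (hG : E(G).Finite) {I J : Set β} (hI : KIndep G k I)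
    (hJ : KIndep G k J) (hIJ : I.ncard < J.ncard) : ∃ e ∈ J, e ∉ I ∧ KIndep G k (insert e I) := by
  by_contra! hcon
  have hIs := ((kIndep_iff hk hG).1 hI).2
  have hJs := ((kIndep_iff hk hG).1 hJ).2
  have hIfin := hG.subset hI.1
  have hJfin := hG.subset hJ.1
  have hVfin : ∀ {Y : Set β}, Y.Finite → V(edgeInduced G Y).Finite := fun hY => finite_ends hY
  have hmono : ∀ {Y Z : Set β}, Y ⊆ Z → V(edgeInduced G Y) ⊆ V(edgeInduced G Z) :=
    fun {_ _} hYZ x ⟨e, he, hx⟩ => ⟨e, hYZ he, hx⟩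
  -- tight subsets of `I`
  let Tight : Set (Set β) := {T | T ⊆ I ∧ T.ncard + 1 = V(edgeInduced G T).ncard + k}
  have hfinT : Tight.Finite := hIfin.finite_subsets.subset fun T hT => hT.1
  have hex : ∀ e ∈ J, e ∉ I → ∃ T ∈ Tight, ∀ x, G.Inc e x → x ∈ V(edgeInduced G T) := by
    intro e heJ heI
    have hdep := hcon e heJ heI
    rw [kIndep_iff hk hG] at hdep
    push Not at hdep
    obtain ⟨Y, hY, hYk⟩ := hdep (Set.insert_subset (hJ.1 heJ) hI.1)
    have hYfin : Y.Finite := (hIfin.insert e).subset hY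
    have heY : e ∈ Y := by
      by_contra he
      have := hIs Y ((Set.subset_insert_iff_of_notMem he).1 hY)
      omega
    have hsub : Y \ {e} ⊆ I := by
      intro f hf
      exact (hY hf.1).resolve_left hf.2
    have h1 := hIs _ hsub
    have h2 := Set.ncard_sdiff_singleton_add_one heY hYfin
    have h3 := Set.ncard_le_ncard (hmono (Set.sdiff_subset (s := Y) (t := {e})))
      (hVfin hYfin)
    have h4 : V(edgeInduced G (Y \ {e})) = V(edgeInduced G Y) :=
      Set.eq_of_subset_of_ncard_le (hmono Set.sdiff_subset) (by omega) (hVfin hYfin)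
    refine ⟨Y \ {e}, ⟨hsub, by omega⟩, fun x hx => ?_⟩
    rw [h4]
    exact ⟨e, heY, hx⟩
  have hunion : ∀ A ∈ Tight, ∀ B ∈ Tight, A ∪ B ∈ Tight := by
    rintro A ⟨hA, hA'⟩ B ⟨hB, hB'⟩
    have hAf := hIfin.subset hA
    have hBf := hIfin.subset hB
    refine ⟨Set.union_subset hA hB, ?_⟩
    have h1 := hIs _ (Set.union_subset hA hB)
    have h2 := hIs (A ∩ B) (Set.inter_subset_left.trans hA)
    have h3 := Set.ncard_union_add_ncard_inter A B hAf hBf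
    have h4 := Set.ncard_union_add_ncard_inter _ _ (hVfin hAf) (hVfin hBf)
    have h5 : V(edgeInduced G (A ∪ B)) = V(edgeInduced G A) ∪ V(edgeInduced G B) := by
      refine subset_antisymm ?_ (Set.union_subset (hmono Set.subset_union_left)
        (hmono Set.subset_union_right))
      rintro x ⟨e, he | he, hx⟩
      · exact Or.inl ⟨e, he, hx⟩
      · exact Or.inr ⟨e, he, hx⟩
    have h6 := Set.ncard_le_ncard (Set.subset_inter
      (hmono (Set.inter_subset_left (s := A) (t := B)))
      (hmono (Set.inter_subset_right (s := A) (t := B)))) ((hVfin hAf).inter_of_left _)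
    rw [h5] at h1 ⊢
    omega
  obtain ⟨e₀, he₀J, he₀I⟩ : ∃ e ∈ J, e ∉ I := by
    by_contra! h
    have := Set.ncard_le_ncard h hIfin
    omega
  obtain ⟨T₀, hT₀, -⟩ := hex e₀ he₀J he₀I
  obtain ⟨T, hT, hTmax⟩ := hfinT.exists_maximal ⟨T₀, hT₀⟩
  have hTf := hIfin.subset hT.1
  have hends : ∀ e ∈ J, e ∉ I → ∀ x, G.Inc e x → x ∈ V(edgeInduced G T) := by
    intro e heJ heI x hx
    obtain ⟨T', hT', h'⟩ := hex e heJ heI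
    exact hmono (Set.subset_union_right.trans (hTmax (hunion _ hT _ hT') Set.subset_union_left))
      (h' x hx)
  have hA := hJs (J \ (I \ T)) Set.sdiff_subset
  have hAV : V(edgeInduced G (J \ (I \ T))) ⊆ V(edgeInduced G T) := by
    rintro x ⟨e, ⟨heJ, he⟩, hx⟩
    by_cases heI : e ∈ I
    · exact ⟨e, by_contra fun h => he ⟨heI, h⟩, hx⟩
    · exact hends e heJ heI x hx
  have h1 := Set.ncard_le_ncard hAV (hVfin hTf)
  have h2 := Set.ncard_sdiff_add_ncard_of_subset hT.1 hIfin
  have h3 := Set.ncard_le_ncard_sdiff_add_ncard J (I \ T) hIfin.sdiff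
  have h4 := hT.2
  omega

lemma kIndep_empty (hk : 1 ≤ k) (hG : E(G).Finite) : KIndep G k ∅ := by
  rw [kIndep_iff hk hG]
  refine ⟨Set.empty_subset _, fun Y hY => ?_⟩
  rw [Set.subset_empty_iff.1 hY, Set.ncard_empty]
  omega

end aux

/-- The `k`-circular matroid `Mₖ(G)` of a finite graph `G`, for `k ≥ 1`: the matroid on the edge
set of `G` whose circuits are the `k`-circuits of `G` (see `isCircuit_iff`). -/
def circularMatroid {α β : Type*} (G : Graph α β) (hG : E(G).Finite) (k : ℕ) (hk : 1 ≤ k) :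
    Matroid β :=
  (IndepMatroid.ofFinite hG (KIndep G k) (kIndep_empty hk hG)
    (fun _ _ hJ hIJ => ⟨hIJ.trans hJ.1, fun C hC hCI => hJ.2 C hC (hCI.trans hIJ)⟩)
    (fun _ _ hI hJ hIJ => kIndep_aug hk hG hI hJ hIJ) (fun _ h => h.1)).matroid

theorem circularMatroid_ground {α β : Type*} (G : Graph α β) (hG : E(G).Finite) (k : ℕ)
    (hk : 1 ≤ k) : (circularMatroid G hG k hk).E = E(G) := rfl

theorem circularMatroid_indep {α β : Type*} (G : Graph α β) (hG : E(G).Finite) (k : ℕ)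
    (hk : 1 ≤ k) (X : Set β) : (circularMatroid G hG k hk).Indep X ↔ KIndep G k X := Iff.rfl

/-- A proper subset of a `k`-circuit has `Δ < k`. -/
lemma eq_of_subset_kCircuit {α β : Type*} {G : Graph α β} {k : ℕ} (hG : E(G).Finite)
    {C Y : Set β} (hC : C ∈ kCircuits G k) (hY : Y ⊆ C)
    (h : V(edgeInduced G Y).ncard + k ≤ Y.ncard) : Y = C := by
  classical
  obtain ⟨hCE, hCk, hcact⟩ := hC
  rw [delta_eq_iff hCE] at hCk
  have hCf := hG.subset hCE
  have hVf : V(edgeInduced G C).Finite := finite_ends hCf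
  have hVY : V(edgeInduced G Y) ⊆ V(edgeInduced G C) := fun x ⟨e, he, hx⟩ => ⟨e, hY he, hx⟩
  set W := V(edgeInduced G C) \ V(edgeInduced G Y) with hW
  have hWf : W.Finite := hVf.sdiff
  have hFf : (C \ Y).Finite := hCf.sdiff
  have h1 := Set.ncard_sdiff_add_ncard_of_subset hVY hVf
  rw [← hW] at h1
  have h2 := Set.ncard_sdiff_add_ncard_of_subset hY hCf
  have hinc : ∀ x ∈ W, ∀ e, (edgeInduced G C).Inc e x → e ∈ C \ Y := by
    rintro x hx e ⟨y, he, hy⟩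
    exact ⟨he, fun heY => hx.2 ⟨e, heY, y, hy⟩⟩
  have hcount := sum_degree_eq (H := edgeInduced G C) hFf.toFinset hWf.toFinset (by
    intro x hx e he
    simpa using hinc x (by simpa using hx) e he)
  have hdeg : ∀ x ∈ hWf.toFinset, 2 ≤ degree (edgeInduced G C) x := by
    intro x hx
    have hx' : x ∈ W := by simpa using hx
    have hn := hcact.no_leaf x hx'.1
    obtain ⟨e, y, hy⟩ := hcact.no_isolated x hx'.1
    have hsum := degree_eq_sum (H := edgeInduced G C) hFf.toFinset x
      (fun e he => by simpa using hinc x hx' e he)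
    have hle := Finset.single_le_sum (f := fun f =>
        (if (edgeInduced G C).IsNonloopAt f x then 1 else 0) +
          2 * (if (edgeInduced G C).IsLoopAt f x then 1 else 0))
        (fun _ _ => Nat.zero_le _)
        (show e ∈ hFf.toFinset by simpa using hinc x hx' e ⟨y, hy⟩)
    have : 1 ≤ (if (edgeInduced G C).IsNonloopAt e x then 1 else 0) +
          2 * (if (edgeInduced G C).IsLoopAt e x then 1 else 0) := by
      rw [mult_eq hy]
      simp
    omega
  have hle : ∀ e ∈ hFf.toFinset, ∑ x ∈ hWf.toFinset,
      ((if (edgeInduced G C).IsNonloopAt e x then 1 else 0) +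
        2 * (if (edgeInduced G C).IsLoopAt e x then 1 else 0)) ≤ 2 := by
    intro e he
    have he' : e ∈ C \ Y := by simpa using he
    obtain ⟨a, b, hab⟩ := exists_isLink_of_mem_edgeSet (hCE he'.1)
    rw [sum_mult_eq _ (show (edgeInduced G C).IsLink e a b from ⟨he'.1, hab⟩)]
    split_ifs <;> simp
  have hs1 := Finset.sum_le_sum hdeg
  have hs2 := Finset.sum_le_sum hle
  have hcW : hWf.toFinset.card = W.ncard := (Set.ncard_eq_toFinset_card W hWf).symm
  have hcF : hFf.toFinset.card = (C \ Y).ncard := (Set.ncard_eq_toFinset_card _ hFf).symm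
  simp only [Finset.sum_const, smul_eq_mul, hcW, hcF] at hs1 hs2
  rcases W.eq_empty_or_nonempty with hemp | ⟨w, hw⟩
  · have : (C \ Y).ncard = 0 := by
      rw [hemp, Set.ncard_empty] at h1
      omega
    rw [Set.ncard_eq_zero hFf, Set.sdiff_eq_empty] at this
    exact subset_antisymm hY this
  · exfalso
    have hdeg2 := (Finset.sum_eq_sum_iff_of_le hdeg).1 (by
      simp only [Finset.sum_const, smul_eq_mul, hcW]
      omega)
    have hle2 := (Finset.sum_eq_sum_iff_of_le hle).1 (by
      simp only [Finset.sum_const, smul_eq_mul, hcF]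
      omega)
    have hclosed : ∀ y ∈ componentVerts (edgeInduced G C) w, y ∈ W := by
      intro y hy
      induction hy with
      | refl => exact hw
      | tail _ hab ih =>
        obtain ⟨e, he⟩ := hab
        have hm := hinc _ ih e he.inc_left
        have h := hle2 e (by simpa using hm)
        rw [sum_mult_eq _ he] at h
        by_contra hb
        simp [hb] at h
        split_ifs at h; omega
    exact hcact.no_cycle_component w hw.1 fun y hy =>
      (hdeg2 y (by simpa using hclosed y hy)).symm

/-- The circuits of `Mₖ(G)` are exactly the `k`-circuits of `G`. -/
theorem isCircuit_iff {α β : Type*} (G : Graph α β) (hG : E(G).Finite) (k : ℕ) (hk : 1 ≤ k)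
    (C : Set β) : (circularMatroid G hG k hk).IsCircuit C ↔ C ∈ kCircuits G k := by
  constructor
  · intro h
    have hdep := h.not_indep
    rw [circularMatroid_indep, KIndep] at hdep
    push Not at hdep
    obtain ⟨D, hD, hDC⟩ := hdep h.subset_ground
    have hDdep : ¬ (circularMatroid G hG k hk).Indep D := fun hi => hi.2 D hD subset_rfl
    rcases hDC.eq_or_ssubset with rfl | hss
    · exact hD
    · exact absurd (h.ssubset_indep hss) hDdep
  · intro hC
    rw [Matroid.isCircuit_iff_minimal_not_indep (show C ⊆ _ from hC.1)]
    refine ⟨fun hi => hi.2 C hC subset_rfl, fun Y hY hYC => ?_⟩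
    change ¬ KIndep G k Y at hY
    rw [kIndep_iff hk hG] at hY
    push Not at hY
    obtain ⟨Z, hZ, hZk⟩ := hY (hYC.trans hC.1)
    have := eq_of_subset_kCircuit hG hC (hZ.trans hYC) hZk
    exact this ▸ hZ

/-- A matroid is connected if it has no loops and no coloops and every two elements belong to a
common circuit. -/
structure IsConnected {β : Type*} (M : Matroid β) : Prop where
  no_loop : ∀ e, ¬ M.IsLoop e
  no_coloop : ∀ e, ¬ M.IsColoop e
  common_circuit : ∀ e ∈ M.E, ∀ f ∈ M.E, ∃ C, M.IsCircuit C ∧ e ∈ C ∧ f ∈ C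

/-- A non-separating cocircuit of a connected matroid `M`. -/
def IsNonSeparatingCocircuit {β : Type*} (M : Matroid β) (K : Set β) : Prop :=
  M.IsCocircuit K ∧ IsConnected (M.delete K)

/-- The set `𝒮(G)` of vertex stars of `G`; the star of `v` is the set of edges incident to `v`. -/
def vertexStars {α β : Type*} (G : Graph α β) : Set (Set β) :=
  {S | ∃ v ∈ V(G), S = G.incidenceSet v}

/-- Strong isomorphism: the two graphs have the same edge set, and a bijection between their vertex
sets carries the ends of each edge in `G` to the ends of the same edge in `G'`. -/
def StronglyIsomorphic {α α' β : Type*} (G : Graph α β) (G' : Graph α' β) : Prop :=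
  E(G) = E(G') ∧ ∃ ν : V(G) ≃ V(G'), ∀ (e : β) (x y : V(G)),
    G.IsLink e x y ↔ G'.IsLink e (ν x) (ν y)

/-- No isolated vertices. -/
def NoIsolated {α β : Type*} (G : Graph α β) : Prop :=
  ∀ x ∈ V(G), (G.incidenceSet x).Nonempty

end KCircular

/-!
If `B` is a basis of a nonempty edge set `X` in `M_k(G)` and the restriction to `X` has no
coloops, then `B` is the union of the sets `C \ {e}`, where `C` is the fundamental circuit of
`e ∈ X \ B`. Each of these is tight, and tight subsets of an independent set are closed under
unions, so `|B| = |V(G⟨X⟩)| + k - 1`.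

Hence, when `M_k(G)` has no coloops, its rank determines `|V(G)|`; and deleting a cocircuit `K`
without creating coloops lowers the rank by one, so `E(G) \ K` misses exactly one vertex, whose
star is then `K`. The condition on `K` only involves the matroid, so `K` is a vertex star of both
graphs, which matches the stars of all vertices but one. The last star follows, as each edge of a
loopless graph lies in exactly two stars.
-/

namespace KCircular

section Matroid

variable {β : Type*} {M : Matroid β} {X B K D : Set β} {e f : β}

/-- A cocircuit whose deletion creates no coloops. This is the part of being a non-separating
cocircuit that forces `K` to be a vertex star. -/
structure IsColooplessCocircuit (M : Matroid β) (K : Set β) : Prop where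
  isCocircuit : M.IsCocircuit K
  no_coloop : ∀ e, ¬ (M.delete K).IsColoop e

lemma IsNonSeparatingCocircuit.isColooplessCocircuit (hK : IsNonSeparatingCocircuit M K) :
    IsColooplessCocircuit M K :=
  ⟨hK.1, hK.2.no_coloop⟩

lemma fundCircuit_sdiff_singleton_subset : M.fundCircuit e B \ {e} ⊆ B :=
  Set.sdiff_singleton_subset_iff.2 (M.fundCircuit_subset_insert e B)

lemma exists_mem_fundCircuit_of_isBasis (hB : M.IsBasis B X)
    (hX : ∀ e, ¬ (M.restrict X).IsColoop e) (he : e ∈ B) :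
    ∃ f ∈ X \ B, e ∈ M.fundCircuit f B := by
  have hnot := hX e
  rw [hB.restrict_isBase.isColoop_iff_forall_notMem_fundCircuit he] at hnot
  push Not at hnot
  obtain ⟨f, hf, hef⟩ := hnot
  rw [Matroid.fundCircuit_restrict hB.subset hf.1 hB.subset_ground] at hef
  exact ⟨f, hf, hef⟩

lemma isBase_insert_of_isCocircuit (hK : M.IsCocircuit K) (hf : f ∈ K)
    (hD : M.IsBasis D (M.E \ K)) : M.IsBase (insert f D) := by
  have hmin := Matroid.isCocircuit_iff_minimal_compl_nonspanning.1 hK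
  have hfE : f ∈ M.E := hK.subset_ground hf
  have hspan : M.Spanning (insert f (M.E \ K)) := by
    have hsub : M.E \ (K \ {f}) ⊆ insert f (M.E \ K) := fun e ⟨heE, he⟩ =>
      or_iff_not_imp_left.2 fun hef => ⟨heE, fun heK => he ⟨heK, hef⟩⟩
    exact (not_not.1 (hmin.not_prop_of_ssubset (Set.sdiff_singleton_ssubset.2 hf))).superset hsub
      (Set.insert_subset hfE Set.sdiff_subset)
  have hfcl : f ∉ M.closure D := fun hmem => hmin.prop <| by
    rw [hD.closure_eq_closure] at hmem
    rw [Matroid.spanning_iff_closure_eq, ← M.closure_insert_eq_of_mem_closure hmem]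
    exact hspan.closure_eq
  exact (hD.insert_isBasis_insert_of_notMem_closure hfcl).isBase_of_spanning hspan

end Matroid

section Rank

variable {α β : Type*} {G : Graph α β} {k : ℕ} {X Y B C K : Set β} {e : β}

lemma vertexSet_edgeInduced_mono (h : X ⊆ Y) : V(edgeInduced G X) ⊆ V(edgeInduced G Y) :=
  fun _ ⟨e, he, hx⟩ => ⟨e, h he, hx⟩

lemma vertexSet_edgeInduced_union :
    V(edgeInduced G (X ∪ Y)) = V(edgeInduced G X) ∪ V(edgeInduced G Y) := by
  ext x
  simp only [edgeInduced, Set.mem_ofPred_eq, Set.mem_union, or_and_right, exists_or]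

lemma vertexSet_edgeInduced_edgeSet (hiso : NoIsolated G) : V(edgeInduced G E(G)) = V(G) :=
  Set.Subset.antisymm (fun _ ⟨_, _, hx⟩ => hx.vertex_mem)
    fun x hx => (hiso x hx).imp fun _ he => ⟨he.edge_mem, he⟩

lemma NoIsolated.finite_vertexSet (hiso : NoIsolated G) (hE : E(G).Finite) : V(G).Finite := by
  rw [← vertexSet_edgeInduced_edgeSet hiso]
  exact finite_ends hE

/-- `T` has one edge fewer than a `k`-circuit on the same vertices, the largest size that an
independent set of `M_k(G)` on these vertices can have. -/
def IsTight (G : Graph α β) (k : ℕ) (T : Set β) : Prop :=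
  T.ncard + 1 = V(edgeInduced G T).ncard + k

-- `X ↦ |V(G⟨X⟩)|` is submodular, and the independent sets `X ∪ Y` and `X ∩ Y` are at most tight.
lemma KIndep.supClosed_isTight (hk : 1 ≤ k) (hE : E(G).Finite) (hB : KIndep G k B) :
    SupClosed {T | T ⊆ B ∧ IsTight G k T} := by
  rintro X ⟨hXB, hX⟩ Y ⟨hYB, hY⟩
  have hXf : X.Finite := hE.subset (hXB.trans hB.1)
  have hYf : Y.Finite := hE.subset (hYB.trans hB.1)
  obtain ⟨-, hlt⟩ := (kIndep_iff hk hE).1 hB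
  have hunion := hlt (X ∪ Y) (Set.union_subset hXB hYB)
  have hinter := hlt (X ∩ Y) (Set.inter_subset_left.trans hXB)
  have hinterV := Set.ncard_le_ncard (Set.subset_inter
    (vertexSet_edgeInduced_mono (G := G) (Set.inter_subset_left (s := X) (t := Y)))
    (vertexSet_edgeInduced_mono Set.inter_subset_right))
    ((finite_ends hXf).inter_of_left _)
  have hcard := Set.ncard_union_add_ncard_inter X Y hXf hYf
  have hcardV := Set.ncard_union_add_ncard_inter V(edgeInduced G X) V(edgeInduced G Y)
    (finite_ends hXf) (finite_ends hYf)
  refine ⟨Set.union_subset hXB hYB, ?_⟩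
  rw [vertexSet_edgeInduced_union] at hunion
  change (X ∪ Y).ncard + 1 = V(edgeInduced G (X ∪ Y)).ncard + k
  rw [vertexSet_edgeInduced_union]
  unfold IsTight at hX hY
  omega

lemma vertexSet_edgeInduced_sdiff_singleton (hE : E(G).Finite) (hC : C ∈ kCircuits G k)
    (he : e ∈ C) : V(edgeInduced G (C \ {e})) = V(edgeInduced G C) := by
  have hCf : C.Finite := hE.subset hC.1
  have hcard := (delta_eq_iff hC.1).1 hC.2.1
  have hcard' := Set.ncard_sdiff_singleton_add_one he hCf
  have hlt : (C \ {e}).ncard < V(edgeInduced G (C \ {e})).ncard + k := by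
    by_contra! hle
    exact (Set.sdiff_singleton_ssubset.2 he).ne (eq_of_subset_kCircuit hE hC Set.sdiff_subset hle)
  exact Set.eq_of_subset_of_ncard_le (vertexSet_edgeInduced_mono Set.sdiff_subset) (by omega)
    (finite_ends hCf)

lemma isTight_sdiff_singleton (hE : E(G).Finite) (hC : C ∈ kCircuits G k) (he : e ∈ C) :
    IsTight G k (C \ {e}) := by
  rw [IsTight, vertexSet_edgeInduced_sdiff_singleton hE hC he,
    Set.ncard_sdiff_singleton_add_one he (hE.subset hC.1), (delta_eq_iff hC.1).1 hC.2.1]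

variable {hE : E(G).Finite} {hk : 1 ≤ k}

lemma fundCircuit_mem_kCircuits (hB : (circularMatroid G hE k hk).IsBasis B X) (he : e ∈ X \ B) :
    (circularMatroid G hE k hk).fundCircuit e B ∈ kCircuits G k :=
  (isCircuit_iff G hE k hk _).1 (hB.indep.fundCircuit_isCircuit (hB.subset_closure he.1) he.2)

lemma vertexSet_edgeInduced_of_isBasis (hB : (circularMatroid G hE k hk).IsBasis B X) :
    V(edgeInduced G B) = V(edgeInduced G X) := by
  refine (vertexSet_edgeInduced_mono hB.subset).antisymm fun x ⟨e, heX, hx⟩ => ?_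
  by_cases heB : e ∈ B
  · exact ⟨e, heB, hx⟩
  have hC := fundCircuit_mem_kCircuits hB ⟨heX, heB⟩
  have heC := (circularMatroid G hE k hk).mem_fundCircuit e B
  have hxC : x ∈ V(edgeInduced G ((circularMatroid G hE k hk).fundCircuit e B \ {e})) := by
    rw [vertexSet_edgeInduced_sdiff_singleton hE hC heC]
    exact ⟨e, heC, hx⟩
  exact vertexSet_edgeInduced_mono fundCircuit_sdiff_singleton_subset hxC

lemma isTight_of_isBasis (hB : (circularMatroid G hE k hk).IsBasis B X) (hne : X.Nonempty)
    (hX : ∀ e, ¬ ((circularMatroid G hE k hk).restrict X).IsColoop e) : IsTight G k B := by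
  set M := circularMatroid G hE k hk
  have hcover : ∀ b ∈ B, ∃ e ∈ X \ B, b ∈ M.fundCircuit e B := fun b hb =>
    exists_mem_fundCircuit_of_isBasis hB hX hb
  have hne' : (X \ B).Nonempty := by
    obtain ⟨e, he⟩ := hne
    by_cases heB : e ∈ B
    · exact (hcover e heB).imp fun f hf => hf.1
    · exact ⟨e, he, heB⟩
  have hfin : (X \ B).Finite := hE.subset (Set.sdiff_subset.trans hB.subset_ground)
  have hunion : ⋃ e ∈ X \ B, M.fundCircuit e B \ {e} = B := by
    refine (Set.iUnion₂_subset fun e _ => fundCircuit_sdiff_singleton_subset).antisymm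
      fun b hb => ?_
    obtain ⟨e, he, hbe⟩ := hcover b hb
    exact Set.mem_biUnion he ⟨hbe, fun h => he.2 (h ▸ hb)⟩
  have hmem := (KIndep.supClosed_isTight hk hE hB.indep).biSup_mem_of_nonempty hfin hne'
    (f := fun e => M.fundCircuit e B \ {e}) fun e he => ⟨fundCircuit_sdiff_singleton_subset,
      isTight_sdiff_singleton hE (fundCircuit_mem_kCircuits hB he) (M.mem_fundCircuit e B)⟩
  exact hunion ▸ hmem.2

lemma ncard_isBase_add_one (hiso : NoIsolated G) (hne : E(G).Nonempty)
    (hcol : ∀ e, ¬ (circularMatroid G hE k hk).IsColoop e)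
    (hB : (circularMatroid G hE k hk).IsBase B) : B.ncard + 1 = V(G).ncard + k := by
  have hB' : (circularMatroid G hE k hk).IsBasis B E(G) := hB.isBasis_ground
  rw [← vertexSet_edgeInduced_edgeSet hiso, ← vertexSet_edgeInduced_of_isBasis hB']
  refine isTight_of_isBasis hB' hne ?_
  rwa [← circularMatroid_ground G hE k hk, Matroid.restrict_ground_eq_self]

lemma IsColooplessCocircuit.ncard_vertexSet_edgeInduced_sdiff_add_one (hiso : NoIsolated G)
    (hcol : ∀ e, ¬ (circularMatroid G hE k hk).IsColoop e)
    (hK : IsColooplessCocircuit (circularMatroid G hE k hk) K) :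
    V(edgeInduced G (E(G) \ K)).ncard + 1 = V(G).ncard := by
  obtain ⟨f, hf⟩ := hK.isCocircuit.nonempty
  have hKE : K ⊆ E(G) := hK.isCocircuit.subset_ground
  obtain ⟨D, hD⟩ := (circularMatroid G hE k hk).exists_isBasis (E(G) \ K) Set.sdiff_subset
  have hins := isBase_insert_of_isCocircuit hK.isCocircuit hf hD
  have hrank := ncard_isBase_add_one hiso ⟨f, hKE hf⟩ hcol hins
  have hfD : f ∉ D := fun h => (hD.subset h).2 hf
  rw [Set.ncard_insert_of_notMem hfD (hE.subset (hD.subset.trans Set.sdiff_subset))] at hrank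
  rcases (E(G) \ K).eq_empty_or_nonempty with hempty | hne
  · have hDempty : D = ∅ := Set.subset_empty_iff.1 (hempty ▸ hD.subset)
    have hVpos : 0 < V(G).ncard := by
      obtain ⟨x, _, hx⟩ := exists_isLink_of_mem_edgeSet (hKE hf)
      exact (Set.ncard_pos (hiso.finite_vertexSet hE)).2 ⟨x, hx.left_mem⟩
    rw [← vertexSet_edgeInduced_of_isBasis hD]
    simp only [hDempty, edgeInduced, Set.mem_empty_iff_false, false_and, exists_false,
      Set.ofPred_false, Set.ncard_empty] at hrank ⊢
    omega
  · have htight : IsTight G k D := isTight_of_isBasis hD hne hK.no_coloop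
    rw [IsTight, vertexSet_edgeInduced_of_isBasis hD] at htight
    omega

lemma IsColooplessCocircuit.existsUnique_incidenceSet_eq (hiso : NoIsolated G)
    (hcol : ∀ e, ¬ (circularMatroid G hE k hk).IsColoop e)
    (hK : IsColooplessCocircuit (circularMatroid G hE k hk) K) :
    ∃! x, x ∈ V(G) ∧ G.incidenceSet x = K := by
  have hKc := hK.isCocircuit
  set W := V(edgeInduced G (E(G) \ K))
  have hmissed : ∃ x, V(G) \ W = {x} := by
    have hWV : W ⊆ V(G) := fun x ⟨_, _, hx⟩ => hx.vertex_mem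
    have hdiff := Set.ncard_sdiff_add_ncard_of_subset hWV (hiso.finite_vertexSet hE)
    have hcard : W.ncard + 1 = V(G).ncard :=
      hK.ncard_vertexSet_edgeInduced_sdiff_add_one hiso hcol
    exact Set.ncard_eq_one.1 (by omega)
  obtain ⟨x, hx⟩ := hmissed
  have hunique : ∀ y ∈ V(G), y ∉ W → y = x := fun y hy hyW => hx.subset ⟨hy, hyW⟩
  obtain ⟨hxV, hxW⟩ : x ∈ V(G) \ W := hx ▸ rfl
  have hxK : G.incidenceSet x ⊆ K := fun f hf =>
    by_contra fun hfK => hxW ⟨f, ⟨hf.edge_mem, hfK⟩, hf⟩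
  have hKx : K ⊆ G.incidenceSet x := fun f hf => by
    obtain ⟨D, hD⟩ := (circularMatroid G hE k hk).exists_isBasis (E(G) \ K) Set.sdiff_subset
    have hbase := (isBase_insert_of_isCocircuit hKc hf hD).isBasis_ground
    rw [← vertexSet_edgeInduced_edgeSet hiso] at hxV
    obtain ⟨g, rfl | hg, hgx⟩ := (vertexSet_edgeInduced_of_isBasis hbase).superset hxV
    · exact hgx
    · exact absurd ⟨g, hD.subset hg, hgx⟩ hxW
  refine ⟨x, ⟨hxV, hxK.antisymm hKx⟩, fun y ⟨hyV, hy⟩ => hunique y hyV ?_⟩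
  rintro ⟨f, ⟨-, hfK⟩, hfy⟩
  exact hfK (hy ▸ hfy)

end Rank

lemma ncard_vertexSet_eq_of_circularMatroid_eq {α α' β : Type*} {G : Graph α β} {G' : Graph α' β}
    {hE : E(G).Finite} {hE' : E(G').Finite} {k : ℕ} {hk : 1 ≤ k}
    (hiso : NoIsolated G) (hiso' : NoIsolated G')
    (hcol : ∀ e, ¬ (circularMatroid G hE k hk).IsColoop e)
    (hM : circularMatroid G' hE' k hk = circularMatroid G hE k hk) :
    V(G).ncard = V(G').ncard := by
  have hEE : E(G) = E(G') := congrArg Matroid.E hM.symm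
  rcases E(G).eq_empty_or_nonempty with hempty | hne
  · rw [← vertexSet_edgeInduced_edgeSet hiso, ← vertexSet_edgeInduced_edgeSet hiso', ← hEE, hempty]
    simp [edgeInduced]
  · obtain ⟨B, hB⟩ := (circularMatroid G hE k hk).exists_isBase
    have hrank := ncard_isBase_add_one hiso hne hcol hB
    have hrank' := ncard_isBase_add_one hiso' (hEE ▸ hne) (hM ▸ hcol) (hM ▸ hB)
    omega

section Stars

variable {α α' β : Type*} {G : Graph α β} {G' : Graph α' β} {e : β}

lemma isLink_iff_inc_and_inc_and_ne (hloop : G.Loopless) {x y : α} :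
    G.IsLink e x y ↔ G.Inc e x ∧ G.Inc e y ∧ x ≠ y := by
  refine ⟨fun h => ⟨h.inc_left, h.inc_right, h.ne⟩, fun ⟨⟨z, hz⟩, hy, hne⟩ => ?_⟩
  rwa [hy.eq_of_isLink_of_ne_left hz hne.symm]

-- An edge has exactly two ends, so at most one end other than `v` precisely when `v` is an end.
lemma inc_iff_subsingleton_inc_ne (hloop : G.Loopless) (v : V(G)) :
    G.Inc e v ↔ e ∈ E(G) ∧ {u : V(G) | u ≠ v ∧ G.Inc e u}.Subsingleton := by
  refine ⟨fun h => ⟨h.edge_mem, fun x ⟨hxv, hx⟩ y ⟨hyv, hy⟩ => Subtype.ext ?_⟩,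
    fun ⟨he, hsub⟩ => ?_⟩
  · rcases h.eq_or_eq_or_eq hx hy with hvx | hvy | hxy
    · exact absurd (Subtype.ext hvx.symm) hxv
    · exact absurd (Subtype.ext hvy.symm) hyv
    · exact hxy
  · obtain ⟨x, y, hxy⟩ := exists_isLink_of_mem_edgeSet he
    by_contra hv
    have hne : ∀ u : V(G), G.Inc e u → u ≠ v := fun u hu huv => hv (huv ▸ hu)
    have hxy' : (⟨x, hxy.left_mem⟩ : V(G)) = ⟨y, hxy.right_mem⟩ :=
      hsub ⟨hne _ hxy.inc_left, hxy.inc_left⟩ ⟨hne _ hxy.inc_right, hxy.inc_right⟩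
    exact hxy.ne (congrArg Subtype.val hxy')

lemma incidenceSet_eq_of_forall_ne (hE : E(G) = E(G')) (hloop : G.Loopless)
    (hloop' : G'.Loopless) (ν : V(G) ≃ V(G')) {v : V(G)}
    (hν : ∀ u ≠ v, G'.incidenceSet (ν u) = G.incidenceSet u) :
    G'.incidenceSet (ν v) = G.incidenceSet v := by
  ext e
  have himage : {w : V(G') | w ≠ ν v ∧ G'.Inc e w} = ν '' {u : V(G) | u ≠ v ∧ G.Inc e u} := by
    ext w
    obtain ⟨u, rfl⟩ := ν.surjective w
    simp only [ν.injective.mem_set_image, Set.mem_ofPred_eq, ν.injective.ne_iff]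
    exact and_congr_right fun huv => Set.ext_iff.1 (hν u huv) e
  rw [Graph.mem_incidenceSet, Graph.mem_incidenceSet, inc_iff_subsingleton_inc_ne hloop,
    inc_iff_subsingleton_inc_ne hloop', hE, himage, ν.injective.subsingleton_image_iff]

lemma vertexStars_eq_of_equiv (ν : V(G) ≃ V(G'))
    (hν : ∀ u, G'.incidenceSet (ν u) = G.incidenceSet u) : vertexStars G = vertexStars G' := by
  refine Set.Subset.antisymm ?_ ?_
  · rintro _ ⟨u, hu, rfl⟩
    exact ⟨ν ⟨u, hu⟩, (ν ⟨u, hu⟩).2, (hν ⟨u, hu⟩).symm⟩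
  · rintro _ ⟨w, hw, rfl⟩
    refine ⟨ν.symm ⟨w, hw⟩, (ν.symm ⟨w, hw⟩).2, ?_⟩
    rw [← hν, ν.apply_symm_apply]

lemma StronglyIsomorphic.of_equiv (hE : E(G) = E(G')) (hloop : G.Loopless) (hloop' : G'.Loopless)
    (ν : V(G) ≃ V(G')) (hν : ∀ u, G'.incidenceSet (ν u) = G.incidenceSet u) :
    StronglyIsomorphic G G' := by
  refine ⟨hE, ν, fun e x y => ?_⟩
  have hinc : ∀ u, G'.Inc e (ν u) ↔ G.Inc e u := fun u => Set.ext_iff.1 (hν u) e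
  rw [isLink_iff_inc_and_inc_and_ne hloop, isLink_iff_inc_and_inc_and_ne hloop', hinc, hinc,
    Subtype.coe_ne_coe, Subtype.coe_ne_coe, ν.injective.ne_iff]

end Stars

lemma exists_equiv_of_injOn {ι κ S : Type*} [Finite ι] [Finite κ] (hcard : Nat.card ι = Nat.card κ)
    {s : Set ι} {a : ι → S} {b : κ → S} (ha : s.InjOn a) (hab : a '' s ⊆ Set.range b) :
    ∃ ν : ι ≃ κ, ∀ i ∈ s, b (ν i) = a i := by
  classical
  have := Fintype.ofFinite ι
  have := Fintype.ofFinite κ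
  rcases isEmpty_or_nonempty κ with hκ | hκ
  · have : IsEmpty ι := Finite.card_eq_zero_iff.1 (hcard.trans Nat.card_of_isEmpty)
    exact ⟨Equiv.equivOfIsEmpty ι κ, isEmptyElim⟩
  have hpre : ∀ i ∈ s, ∃ j, b j = a i := fun i hi => hab ⟨i, hi, rfl⟩
  choose! f hf using hpre
  have hinj : s.InjOn f := fun i hi j hj hij => ha hi hj (by rw [← hf i hi, ← hf j hj, hij])
  obtain ⟨g, hg⟩ := Set.MapsTo.exists_equiv_extend_of_card_eq (t := Finset.univ) (s := s) (f := f)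
    (by simpa [Nat.card_eq_fintype_card] using hcard) (fun _ _ => Finset.mem_univ _) hinj
  exact ⟨g.trans (Equiv.subtypeUnivEquiv Finset.mem_univ), fun i hi => by
    rw [Equiv.trans_apply, Equiv.subtypeUnivEquiv_apply, hg i hi, hf i hi]⟩

end KCircular

theorem mainTheorem10_general {α α' β : Type*} (G : Graph α β) (G' : Graph α' β) (k : ℕ)
    (hk : 1 ≤ k) (hE : E(G).Finite) (hE' : E(G').Finite)
    (hiso : KCircular.NoIsolated G) (hiso' : KCircular.NoIsolated G')
    (hloop : G.Loopless) (hloop' : G'.Loopless)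
    (hcol : ∀ e, ¬ (KCircular.circularMatroid G hE k hk).IsColoop e)
    (hstar : {v | v ∈ V(G) ∧ ¬ KCircular.IsColooplessCocircuit
      (KCircular.circularMatroid G hE k hk) (G.incidenceSet v)}.Subsingleton)
    (hM : KCircular.circularMatroid G' hE' k hk = KCircular.circularMatroid G hE k hk) :
    KCircular.vertexStars G = KCircular.vertexStars G' ∧ KCircular.StronglyIsomorphic G G' := by
  have hEE : E(G) = E(G') := congrArg Matroid.E hM.symm
  have := (hiso.finite_vertexSet hE).to_subtype
  have := (hiso'.finite_vertexSet hE').to_subtype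
  let s : Set V(G) := {u | KCircular.IsColooplessCocircuit
    (KCircular.circularMatroid G hE k hk) (G.incidenceSet u)}
  have hinj : s.InjOn fun u : V(G) => G.incidenceSet u := fun u hu w _ huw =>
    Subtype.ext ((hu.existsUnique_incidenceSet_eq hiso hcol).unique ⟨u.2, rfl⟩ ⟨w.2, huw.symm⟩)
  have hrange : (fun u : V(G) => G.incidenceSet u) '' s ⊆
      Set.range fun w : V(G') => G'.incidenceSet w := by
    rintro _ ⟨u, hu, rfl⟩
    rw [Set.mem_ofPred_eq, ← hM] at hu
    obtain ⟨w, hw, hwu⟩ := (hu.existsUnique_incidenceSet_eq hiso' (hM ▸ hcol)).exists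
    exact ⟨⟨w, hw⟩, hwu⟩
  obtain ⟨ν, hν⟩ := KCircular.exists_equiv_of_injOn
    (KCircular.ncard_vertexSet_eq_of_circularMatroid_eq hiso hiso' hcol hM) hinj hrange
  have hstars : ∀ u, G'.incidenceSet (ν u) = G.incidenceSet u := fun u => by
    by_cases hu : u ∈ s
    · exact hν u hu
    · refine KCircular.incidenceSet_eq_of_forall_ne hEE hloop hloop' ν fun w hwu => hν w ?_
      exact by_contra fun hw => hwu (Subtype.ext (hstar ⟨w.2, hw⟩ ⟨u.2, hu⟩))
  exact ⟨KCircular.vertexStars_eq_of_equiv ν hstars, .of_equiv hEE hloop hloop' ν hstars⟩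

theorem mainTheorem10 {α α' β : Type*} (G : Graph α β) (G' : Graph α' β) (k : ℕ) (hk : 1 ≤ k)
    (hV : V(G).Finite) (hE : E(G).Finite) (hV' : V(G').Finite) (hE' : E(G').Finite)
    (hiso : KCircular.NoIsolated G) (hiso' : KCircular.NoIsolated G')
    (hloop : G.Loopless) (hloop' : G'.Loopless)
    (hconn : KCircular.IsConnected (KCircular.circularMatroid G hE k hk))
    (hstar : ∃! v, v ∈ V(G) ∧ ¬ KCircular.IsNonSeparatingCocircuit
      (KCircular.circularMatroid G hE k hk) (G.incidenceSet v))
    (hM : KCircular.circularMatroid G' hE' k hk = KCircular.circularMatroid G hE k hk) :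
    KCircular.vertexStars G = KCircular.vertexStars G' ∧ KCircular.StronglyIsomorphic G G' :=
  mainTheorem10_general G G' k hk hE hE' hiso hiso' hloop hloop' hconn.no_coloop
    (fun _ hu _ hw => hstar.unique (hu.imp_right fun h hns => h hns.isColooplessCocircuit)
      (hw.imp_right fun h hns => h hns.isColooplessCocircuit)) hM
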